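/- Let $\lambda>0$ and, for $\varepsilon>0$, consider the equation for $\varphi=\varphi(\theta)$, $\theta\in\mathbb R$, $$\varphi_{\theta\theta}+\sin\varphi-\varepsilon^2\frac{\lambda^2}{2}+\varepsilon^2\frac{\sin(2\varphi)}{2}=-\varepsilon^3\theta\,\frac{\lambda^2}{2}\sin\varphi .$$ For $\theta>-2/(\lambda^2\varepsilon^3)$ put $$S=S(\theta)=\frac{4}{3\lambda^2\varepsilon^3}\Bigl(1+\frac{\lambda^2\varepsilon^3\theta}{2}\Bigr)^{3/2},$$ so that $S>0$ and $S\to\infty$ as $\theta\to\infty$. Then for every integer $k$ and every $\varepsilon>0$ the equation has a solution $\varphi_k:\mathbb R\to\mathbb R$ (a slowly varying equilibrium) with the algebraic asymptotic expansion $$\varphi_k=\pi k+(-1)^k\sqrt[3]{\frac{2\lambda^2}{9S^2}}-\frac{2}{3S}\sqrt[3]{\frac{4}{3\lambda^2S}}+O(S^{-2}),\qquad S\to\infty .$$ More precisely, for all $\lambda>0$ and $k\in\mathbb Z$ there are constants $C$ and $S_0>0$, depending only on $\lambda$ and $k$, such that for every $\varepsilon>0$ there is such a solution whose remainder is at most $C\,S^{-2}$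 in absolute value whenever $S\ge S_0$. -/

import Mathlib

namespace ParametricAutoresonance

noncomputable section

/-- `φ : ℝ → ℝ` is a (global, twice differentiable) solution of
`φ'' + sin φ - ε² λ²/2 + ε² sin(2φ)/2 = -ε³ θ (λ²/2) sin φ`. -/
def IsSolution (lam ε : ℝ) (φ : ℝ → ℝ) : Prop :=
  Differentiable ℝ φ ∧ Differentiable ℝ (deriv φ) ∧
    ∀ θ : ℝ,
      deriv (deriv φ) θ + Real.sin (φ θ) - ε ^ 2 * (lam ^ 2 / 2)
          + ε ^ 2 * (Real.sin (2 * φ θ) / 2)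
        = -ε ^ 3 * θ * (lam ^ 2 / 2) * Real.sin (φ θ)

/-- The WKB-type variable `S = 4 / (3 λ² ε³) * (√(1 + λ² σ / 2))³` with `σ = ε³ θ`.
It is an increasing bijection from `θ ≥ -2 / (λ² ε³)` onto `S ≥ 0`. -/
def wkbS (lam ε θ : ℝ) : ℝ :=
  4 / (3 * lam ^ 2 * ε ^ 3) * Real.sqrt (1 + lam ^ 2 * (ε ^ 3 * θ) / 2) ^ 3

/-- The explicit part of the asymptotic expansion of the `k`-th slowly varying equilibrium:
`π k + (-1)^k (2 λ² / (9 S²))^(1/3) - (2 / (3 S)) (4 / (3 λ² S))^(1/3)`, used for `S > 0`. -/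
def equilibriumExpansion (lam : ℝ) (k : ℤ) (S : ℝ) : ℝ :=
  Real.pi * (k : ℝ)
    + (2 * lam ^ 2 / (9 * S ^ 2)) ^ (1 / 3 : ℝ) * (-1 : ℝ) ^ k
    - 2 / (3 * S) * (4 / (3 * lam ^ 2 * S)) ^ (1 / 3 : ℝ)

end

end ParametricAutoresonance

/-! Put b = λ²/2, s = (-1)^k, x = ε⁻² + bεθ and φ = πk + ψ(x). The equation becomes b²ψ'' = b -
sin(2ψ)/2 - s x sin ψ, which is free of ε, and S is a constant depending on λ times x^(3/2). So a
single solution ψ = sb/x - b/x² + O(x⁻³) on x → ∞ serves every ε, and uniformity of the constants is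
automatic (`isSolution_of_isPhaseCurve`, `wkbS_eq`, `equilibriumExpansion_eq`).

A formal expansion to order x⁻⁴ leaves a residual O(x⁻⁴) (`exists_approxEquilibrium_bounds`). The
difference w between a solution and this expansion obeys b²w'' + (1 + sx)w = small, and the sign s
decides how it is controlled.

For s = 1 the equation for w oscillates. Solutions that agree with the expansion, with first
derivative, at x = N satisfy a backward energy bound independent of N (`oscillator_energy_le`);
compactness of their data at a fixed point gives a limit as N → ∞.

For s = -1 the equation is repelling. In a one-parameter family of initial data, those leaving the
tube |w| ≤ x⁻³ upwards and those leaving it downwards form disjoint nonempty open sets, so by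
connectedness some trajectory leaves through neither side and stays in the tube. -/

namespace ParametricAutoresonance

open Set Metric

/-! ### Global existence and Lipschitz dependence for phase curves -/

/-- A `C¹` vector field of at most linear growth has global integral curves. -/
theorem exists_global_integralCurve_of_linear_growth {E : Type*} [NormedAddCommGroup E]
    [NormedSpace ℝ E] [FiniteDimensional ℝ E] (v : E → E) (hv : ContDiff ℝ 1 v) {B : ℝ}
    (hB : ∀ x, ‖v x‖ ≤ B * (1 + ‖x‖)) (x : E) :
    ∃ γ : ℝ → E, γ 0 = x ∧ ∀ t, HasDerivAt γ (v (γ t)) t := by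
  have hB0 : 0 ≤ B := by
    have := (norm_nonneg _).trans (hB 0)
    simpa using this
  have : ProperSpace E := FiniteDimensional.proper_real E
  have : CompleteSpace E := FiniteDimensional.complete ℝ E
  -- On the ball of radius ‖x‖ + 1 about x the speed is at most 2B(‖x‖ + 1). The radius grows in
  -- proportion, so one existence time suits all starting points and the local curves can be
  -- continued forever.
  set τ : ℝ := 1 / (2 * B + 1) with hτ
  have hτ0 : 0 < τ := by positivity
  have hsec := contMDiff_vectorSpace_iff_contDiff (n := 1) (V := v) |>.2 hv
  have key : ∀ x : E, ∃ γ : ℝ → E, γ 0 = x ∧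
      IsMIntegralCurveOn (I := modelWithCornersSelf ℝ E) γ v (Ioo (-τ) τ) := by
    intro x
    let a : NNReal := ⟨‖x‖ + 1, by positivity⟩
    let L : NNReal := ⟨B * (2 * ‖x‖ + 2), by positivity⟩
    obtain ⟨K, hK⟩ := (hv.contDiffOn (s := closedBall x a)).exists_lipschitzOnWith one_ne_zero
      (convex_closedBall _ _) (isCompact_closedBall _ _)
    have h0 : (0 : ℝ) ∈ Icc (-τ) τ := ⟨by linarith, hτ0.le⟩
    have hPL : IsPicardLindelof (fun _ => v) (⟨0, h0⟩ : Icc (-τ) τ) x a 0 L K := by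
      refine IsPicardLindelof.of_time_independent ?_ hK ?_
      · intro z hz
        refine (hB z).trans ?_
        have h1 : ‖z‖ ≤ 2 * ‖x‖ + 1 := by
          have h2 : ‖z - x‖ ≤ ‖x‖ + 1 := dist_eq_norm z x ▸ mem_closedBall.1 hz
          have h3 := norm_add_le (z - x) x
          rw [sub_add_cancel] at h3
          linarith
        exact mul_le_mul_of_nonneg_left (by linarith) hB0
      · change B * (2 * ‖x‖ + 2) * max (τ - 0) (0 - -τ) ≤ (‖x‖ + 1) - 0
        rw [sub_zero, sub_zero, zero_sub, neg_neg, max_self, hτ, mul_one_div,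
          div_le_iff₀ (by positivity)]
        nlinarith [norm_nonneg x]
    obtain ⟨γ, hγ0, hγ⟩ := hPL.exists_eq_forall_mem_Icc_hasDerivWithinAt₀
    refine ⟨γ, hγ0, fun t ht => ?_⟩
    have h1 := (hγ t (Ioo_subset_Icc_self ht)).hasDerivAt (Icc_mem_nhds ht.1 ht.2)
    have h2 : HasFDerivAt γ (ContinuousLinearMap.toSpanSingleton ℝ (v (γ t))) t := h1.hasFDerivAt
    exact h2.hasMFDerivAt.hasMFDerivWithinAt
  obtain ⟨γ, h0, hγ⟩ := exists_isMIntegralCurve_of_isMIntegralCurveOn hsec hτ0 key x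
  refine ⟨γ, h0, fun t => ?_⟩
  have h1 : HasFDerivAt γ (ContinuousLinearMap.toSpanSingleton ℝ (v (γ t))) t :=
    hasMFDerivAt_iff_hasFDerivAt.1 (hγ t)
  exact h1.hasDerivAt.congr_deriv (by simp)

/-- `z = (ψ, ψ')` is the phase curve of a global solution of `ψ'' = g(x, ψ)`. -/
def IsPhaseCurve (g : ℝ → ℝ → ℝ) (z : ℝ → ℝ × ℝ) : Prop :=
  ∀ x, HasDerivAt z ((z x).2, g x (z x).1) x

theorem IsPhaseCurve.hasDerivAt_fst {g : ℝ → ℝ → ℝ} {z : ℝ → ℝ × ℝ} (hz : IsPhaseCurve g z)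
    (x : ℝ) : HasDerivAt (fun x => (z x).1) (z x).2 x :=
  (hasFDerivAt_fst.comp_hasDerivAt x (hz x)).congr_deriv rfl

theorem IsPhaseCurve.hasDerivAt_snd {g : ℝ → ℝ → ℝ} {z : ℝ → ℝ × ℝ} (hz : IsPhaseCurve g z)
    (x : ℝ) : HasDerivAt (fun x => (z x).2) (g x (z x).1) x :=
  (hasFDerivAt_snd.comp_hasDerivAt x (hz x)).congr_deriv rfl

theorem IsPhaseCurve.continuous {g : ℝ → ℝ → ℝ} {z : ℝ → ℝ × ℝ} (hz : IsPhaseCurve g z) :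
    Continuous z :=
  continuous_iff_continuousAt.2 fun x => (hz x).continuousAt

/-- Adjoining time as a coordinate of unit speed makes the system autonomous; since the bound on the
force does not involve u, the enlarged field has linear growth. -/
theorem exists_isPhaseCurve {g : ℝ → ℝ → ℝ} (hg : ContDiff ℝ 1 (Function.uncurry g)) {B : ℝ}
    (hB : ∀ x u, |g x u| ≤ B * (1 + |x|)) (x₀ : ℝ) (z₀ : ℝ × ℝ) :
    ∃ z, IsPhaseCurve g z ∧ z x₀ = z₀ := by
  have hB0 : 0 ≤ B := by
    have := (abs_nonneg _).trans (hB 0 0)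
    simpa using this
  let v : ℝ × ℝ × ℝ → ℝ × ℝ × ℝ := fun y => (1, y.2.2, g y.1 y.2.1)
  have hv : ContDiff ℝ 1 v := by
    refine contDiff_const.prodMk (ContDiff.prodMk (by fun_prop) ?_)
    exact hg.comp (by fun_prop : ContDiff ℝ 1 fun y : ℝ × ℝ × ℝ => (y.1, y.2.1))
  have hgrow : ∀ y, ‖v y‖ ≤ (B + 1) * (1 + ‖y‖) := by
    intro y
    have h1 : |y.1| ≤ ‖y‖ := norm_fst_le y
    have h2 : |y.2.2| ≤ ‖y‖ := (norm_snd_le y.2).trans (norm_snd_le y)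
    have h0 := norm_nonneg y
    have h3 := hB y.1 y.2.1
    refine norm_prod_le_iff.2 ⟨?_, norm_prod_le_iff.2 ⟨?_, ?_⟩⟩
    · simp only [v, norm_one]; nlinarith
    · simp only [v, Real.norm_eq_abs]; nlinarith
    · simp only [v, Real.norm_eq_abs]; nlinarith
  obtain ⟨γ, h0, hγ⟩ := exists_global_integralCurve_of_linear_growth v hv hgrow (x₀, z₀)
  have hfst : ∀ t, HasDerivAt (fun t => (γ t).1) 1 t := fun t =>
    (hasFDerivAt_fst.comp_hasDerivAt t (hγ t)).congr_deriv rfl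
  have hsnd : ∀ t, HasDerivAt (fun t => (γ t).2) ((γ t).2.2, g (γ t).1 (γ t).2.1) t := fun t =>
    (hasFDerivAt_snd.comp_hasDerivAt t (hγ t)).congr_deriv rfl
  have htime : ∀ t, (γ t).1 = x₀ + t := by
    have hconst : ∀ t, HasDerivAt (fun t => (γ t).1 - t) 0 t := fun t => by
      exact ((hfst t).sub (hasDerivAt_id t)).congr_deriv (sub_self _)
    intro t
    have := is_const_of_deriv_eq_zero (fun t => (hconst t).differentiableAt)
      (fun t => (hconst t).deriv) t 0
    simp only [h0] at this
    linarith
  refine ⟨fun x => (γ (x - x₀)).2, fun x => ?_, by simp [h0]⟩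
  have h1 := (hsnd (x - x₀)).comp_sub_const x x₀
  rw [htime, add_sub_cancel] at h1
  exact h1

/-- Lipschitz dependence of phase curves on their initial data. -/
theorem exists_dist_le_of_isPhaseCurve {g : ℝ → ℝ → ℝ} {B : ℝ}
    (hlip : ∀ x u u', |g x u - g x u'| ≤ B * (1 + |x|) * |u - u'|) (x₀ x₁ : ℝ) :
    ∃ L : ℝ, 0 < L ∧ ∀ z z', IsPhaseCurve g z → IsPhaseCurve g z' →
      ∀ x ∈ Icc x₀ x₁, dist (z x) (z' x) ≤ L * dist (z x₀) (z' x₀) := by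
  have hB0 : 0 ≤ B := by
    have := (abs_nonneg _).trans (hlip 0 1 0)
    simpa using this
  let K : NNReal := ⟨1 + B * (1 + |x₀| + |x₁|), by positivity⟩
  refine ⟨Real.exp (K * (x₁ - x₀)), Real.exp_pos _, fun z z' hz hz' x hx => ?_⟩
  have hL : ∀ t ∈ Ico x₀ x₁, LipschitzOnWith K (fun y : ℝ × ℝ => (y.2, g t y.1)) univ := by
    intro t ht
    refine LipschitzOnWith.of_dist_le_mul fun y _ y' _ => ?_
    have htabs : |t| ≤ |x₀| + |x₁| := by
      rcases abs_cases t with h | h <;> rcases abs_cases x₀ with h' | h' <;>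
      rcases abs_cases x₁ with h'' | h'' <;> linarith [ht.1, ht.2]
    have h1 : |y.1 - y'.1| ≤ dist y y' := le_max_left _ _
    have h2 : |y.2 - y'.2| ≤ dist y y' := le_max_right _ _
    have h0 : 0 ≤ dist y y' := dist_nonneg
    change max (dist y.2 y'.2) (dist (g t y.1) (g t y'.1)) ≤ (1 + B * (1 + |x₀| + |x₁|)) * dist y y'
    have hKp : 0 ≤ B * (1 + |x₀| + |x₁|) := by positivity
    refine max_le ?_ ?_
    · rw [Real.dist_eq]; nlinarith
    · rw [Real.dist_eq]
      calc |g t y.1 - g t y'.1| ≤ B * (1 + |t|) * |y.1 - y'.1| := hlip _ _ _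
        _ ≤ B * (1 + |x₀| + |x₁|) * dist y y' := by
          gcongr ?_ * ?_
          gcongr B * ?_
          linarith
        _ ≤ _ := by nlinarith
  have h := dist_le_of_trajectories_ODE_of_mem (s := fun _ => univ) hL hz.continuous.continuousOn
    (fun t _ => (hz t).hasDerivWithinAt) (fun _ _ => mem_univ _) hz'.continuous.continuousOn
    (fun t _ => (hz' t).hasDerivWithinAt) (fun _ _ => mem_univ _) le_rfl x hx
  rw [mul_comm]
  refine h.trans ?_
  gcongr
  exact hx.2

end ParametricAutoresonance

/-! ### The formal expansion, its residual, and bounds on the force -/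

namespace ParametricAutoresonance

open Set

noncomputable section

/-- The right-hand side of the rescaled equation `ψ'' = equilibriumForce b s x ψ`. -/
def equilibriumForce (b s x u : ℝ) : ℝ :=
  (b - Real.sin (2 * u) / 2 - s * x * Real.sin u) / b ^ 2

/-- The first four terms of the formal expansion at infinity of the slowly varying solution. -/
def approxEquilibrium (b s x : ℝ) : ℝ :=
  s * b * x⁻¹ - b * x⁻¹ ^ 2 + s * (b + b ^ 3 / 6) * x⁻¹ ^ 3 - (b + 2 * b ^ 3) * x⁻¹ ^ 4

def approxEquilibriumDeriv (b s x : ℝ) : ℝ :=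
  -(s * b) * x⁻¹ ^ 2 + 2 * b * x⁻¹ ^ 3 - 3 * s * (b + b ^ 3 / 6) * x⁻¹ ^ 4
    + 4 * (b + 2 * b ^ 3) * x⁻¹ ^ 5

def approxEquilibriumDeriv₂ (b s x : ℝ) : ℝ :=
  2 * (s * b) * x⁻¹ ^ 3 - 6 * b * x⁻¹ ^ 4 + 12 * s * (b + b ^ 3 / 6) * x⁻¹ ^ 5
    - 20 * (b + 2 * b ^ 3) * x⁻¹ ^ 6

theorem hasDerivAt_inv_pow {x : ℝ} (hx : x ≠ 0) (n : ℕ) :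
    HasDerivAt (fun x : ℝ => x⁻¹ ^ n) (-(n : ℝ) * x⁻¹ ^ (n + 1)) x := by
  rcases n with _ | n
  · simpa using hasDerivAt_const x (1 : ℝ)
  · refine ((hasDerivAt_inv hx).pow (n + 1)).congr_deriv ?_
    push_cast
    rw [inv_pow, inv_pow]
    field_simp
    ring

theorem hasDerivAt_approxEquilibrium (b s : ℝ) {x : ℝ} (hx : x ≠ 0) :
    HasDerivAt (approxEquilibrium b s) (approxEquilibriumDeriv b s x) x := by
  have h1 := (hasDerivAt_inv_pow hx 1).const_mul (s * b)
  have h2 := (hasDerivAt_inv_pow hx 2).const_mul b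
  have h3 := (hasDerivAt_inv_pow hx 3).const_mul (s * (b + b ^ 3 / 6))
  have h4 := (hasDerivAt_inv_pow hx 4).const_mul (b + 2 * b ^ 3)
  refine ((((h1.sub h2).add h3).sub h4).congr_deriv ?_).congr_of_eventuallyEq
    (Filter.Eventually.of_forall fun y => ?_)
  · simp only [approxEquilibriumDeriv]; push_cast; ring
  · simp [approxEquilibrium]

theorem hasDerivAt_approxEquilibriumDeriv (b s : ℝ) {x : ℝ} (hx : x ≠ 0) :
    HasDerivAt (approxEquilibriumDeriv b s) (approxEquilibriumDeriv₂ b s x) x := by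
  have h1 := (hasDerivAt_inv_pow hx 2).const_mul (-(s * b))
  have h2 := (hasDerivAt_inv_pow hx 3).const_mul (2 * b)
  have h3 := (hasDerivAt_inv_pow hx 4).const_mul (3 * s * (b + b ^ 3 / 6))
  have h4 := (hasDerivAt_inv_pow hx 5).const_mul (4 * (b + 2 * b ^ 3))
  refine ((((h1.add h2).sub h3).add h4).congr_deriv ?_).congr_of_eventuallyEq
    (Filter.Eventually.of_forall fun y => ?_)
  · simp only [approxEquilibriumDeriv₂]; push_cast; ring
  · simp [approxEquilibriumDeriv]

/-- Taylor's bound covers |u| ≤ 1; beyond that every term is dominated by |u|⁵, so no smallness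
hypothesis is needed. -/
theorem abs_sin_sub_cubic_le (u : ℝ) :
    |Real.sin u - (u - u ^ 3 / 6)| ≤ 3 * |u| ^ 5 := by
  rcases le_total |u| 1 with h | h
  · exact (Real.sin_bound h).trans (by have := pow_nonneg (abs_nonneg u) 5; linarith)
  · have h1 : |Real.sin u - (u - u ^ 3 / 6)| ≤ |Real.sin u| + (|u| + |u| ^ 3 / 6) := by
      refine (abs_sub _ _).trans ?_
      gcongr
      refine (abs_sub _ _).trans ?_
      rw [abs_div, abs_pow, abs_of_pos (by norm_num : (0 : ℝ) < 6)]
    have h2 := Real.abs_sin_le_one u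
    have h3 : |u| ^ 1 ≤ |u| ^ 5 := pow_le_pow_right₀ h (by norm_num)
    have h4 : |u| ^ 3 ≤ |u| ^ 5 := pow_le_pow_right₀ h (by norm_num)
    have h5 : 1 ≤ |u| ^ 5 := one_le_pow₀ h
    rw [pow_one] at h3
    linarith

/-- Mean value inequality for sin t - t, whose derivative is at most t²/2 in absolute value. -/
theorem abs_sin_add_sub_sin_sub_le (u w : ℝ) :
    |Real.sin (u + w) - Real.sin u - w| ≤ (|u| + |w|) ^ 2 / 2 * |w| := by
  have hd : ∀ t ∈ uIcc u (u + w),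
      HasDerivWithinAt (fun t => Real.sin t - t) (Real.cos t - 1) (uIcc u (u + w)) t := fun t _ =>
    ((Real.hasDerivAt_sin t).sub (hasDerivAt_id t)).hasDerivWithinAt
  have hb : ∀ t ∈ uIcc u (u + w), ‖Real.cos t - 1‖ ≤ (|u| + |w|) ^ 2 / 2 := by
    intro t ht
    have h1 : |t| ≤ |u| + |w| := by
      have := abs_sub_left_of_mem_uIcc ht
      have h2 := abs_add_le u (t - u)
      rw [add_sub_cancel_left] at this
      rw [add_sub_cancel] at h2
      linarith
    rw [Real.norm_eq_abs, abs_of_nonpos (by linarith [Real.cos_le_one t])]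
    have h2 := Real.one_sub_sq_div_two_le_cos (x := t)
    have h3 : t ^ 2 ≤ (|u| + |w|) ^ 2 := sq_le_sq' (by linarith [neg_abs_le t]) (by linarith [le_abs_self t])
    linarith
  have := (convex_uIcc u (u + w)).norm_image_sub_le_of_norm_hasDerivWithin_le hd hb
    left_mem_uIcc right_mem_uIcc
  simp only [Real.norm_eq_abs, add_sub_cancel_left] at this
  calc |Real.sin (u + w) - Real.sin u - w| = |Real.sin (u + w) - (u + w) - (Real.sin u - u)| := by
        congr 1; ring
    _ ≤ _ := this

/-- With y = x⁻¹ and u = y q(y), the product x u equals q(y), so once the sines are replaced by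
cubics the residual is a polynomial in y. The four coefficients of the expansion are exactly those
that kill its terms of degree below 4, using s² = 1. -/
theorem exists_polynomial_residual (b : ℝ) {s : ℝ} (hs : s = 1 ∨ s = -1) :
    ∃ P : ℝ → ℝ, Continuous P ∧ ∀ x : ℝ, x ≠ 0 → ∀ u, u = approxEquilibrium b s x →
      b - (u - 2 / 3 * u ^ 3) - s * x * (u - u ^ 3 / 6) - b ^ 2 * approxEquilibriumDeriv₂ b s x
        = x⁻¹ ^ 4 * P x⁻¹ := by
  refine ⟨fun y => (b + 7*b^3 + (1/12)*b^5) + ((-29/3)*s*b^3 + (-17/6)*s*b^5)*y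
    + ((46/3)*b^3 + (451/12)*b^5 + (1/72)*b^7)*y^2
    + (6*s*b^3 + (17/3)*s*b^5 + (-7/24)*s*b^7)*y^3
    + ((-19/3)*b^3 + (-109/12)*b^5 + (23/24)*b^7 + (1/1296)*b^9)*y^4
    + ((17/3)*s*b^3 + (83/6)*s*b^5 + (169/24)*s*b^7 + (-2/81)*s*b^9)*y^5
    + ((-7/2)*b^3 + (-127/12)*b^5 + (-127/18)*b^7 + (2/9)*b^9)*y^6
    + ((11/6)*s*b^3 + (22/3)*s*b^5 + (22/3)*s*b^7)*y^7
    + ((-2/3)*b^3 + (-4)*b^5 + (-8)*b^7 + (-16/3)*b^9)*y^8, by fun_prop, ?_⟩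
  intro x hx u hu
  obtain ⟨y, hy⟩ : ∃ y, y = x⁻¹ := ⟨_, rfl⟩
  set q : ℝ := s * b - b * y + s * (b + b ^ 3 / 6) * y ^ 2 - (b + 2 * b ^ 3) * y ^ 3 with hq
  have huq : u = y * q := by rw [hu, approxEquilibrium, ← hy, hq]; ring
  have hxy : x * y = 1 := by rw [hy]; exact mul_inv_cancel₀ hx
  have h1 : s * x * (u - u ^ 3 / 6) = s * (q - y ^ 2 * q ^ 3 / 6) := by
    rw [huq]; linear_combination (s * (q - y ^ 2 * q ^ 3 / 6)) * hxy
  rw [h1, huq, approxEquilibriumDeriv₂, ← hy, hq]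
  rcases hs with rfl | rfl <;> ring

theorem exists_approxEquilibrium_bounds {b : ℝ} (hb : 0 < b) {s : ℝ} (hs : s = 1 ∨ s = -1) :
    ∃ K : ℝ, 0 < K ∧ ∀ x : ℝ, 1 ≤ x →
      |approxEquilibrium b s x| ≤ K / x ∧
      |approxEquilibrium b s x - (s * b / x - b / x ^ 2)| ≤ K / x ^ 3 ∧
      |b ^ 2 * (equilibriumForce b s x (approxEquilibrium b s x)
        - approxEquilibriumDeriv₂ b s x)| ≤ K / x ^ 4 := by
  obtain ⟨P, hP, hPeq⟩ := exists_polynomial_residual b hs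
  obtain ⟨M, hM⟩ := (isCompact_Icc (a := (0 : ℝ)) (b := 1)).exists_bound_of_continuousOn
    hP.continuousOn
  have hsabs : |s| = 1 := by rcases hs with rfl | rfl <;> simp
  set c₃ := b + b ^ 3 / 6 with hc₃
  set c₄ := b + 2 * b ^ 3 with hc₄
  have hc₃0 : 0 < c₃ := by positivity
  have hc₄0 : 0 < c₄ := by positivity
  set Q := 2 * b + c₃ + c₄ with hQ
  have hQ0 : 0 < Q := by positivity
  have hM0 : 0 ≤ M := (norm_nonneg _).trans (hM 0 ⟨le_rfl, zero_le_one⟩)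
  -- Here Q bounds x|u|, M bounds the polynomial factor on [0, 1], and 51 = 96/2 + 3 collects the
  -- quintic errors of sin(2u)/2 and x sin u.
  refine ⟨Q + M + 51 * Q ^ 5, by positivity, fun x hx => ?_⟩
  have hx0 : 0 < x := by linarith
  obtain ⟨y, hy⟩ : ∃ y, y = x⁻¹ := ⟨_, rfl⟩
  have hy0 : 0 < y := by rw [hy]; positivity
  have hy1 : y ≤ 1 := by rw [hy]; exact inv_le_one_of_one_le₀ hx
  have hxy : x * y = 1 := by rw [hy]; exact mul_inv_cancel₀ hx0.ne'
  have hy2 : y ^ 2 ≤ y := by simpa using pow_le_pow_of_le_one hy0.le hy1 one_le_two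
  have hy3 : y ^ 3 ≤ y := by
    simpa using pow_le_pow_of_le_one hy0.le hy1 (show 1 ≤ 3 by norm_num)
  have hy4 : y ^ 4 ≤ y ^ 3 := pow_le_pow_of_le_one hy0.le hy1 (show 3 ≤ 4 by norm_num)
  have hdiv : ∀ n : ℕ, ∀ c : ℝ, c / x ^ n = c * y ^ n := fun n c => by
    rw [hy, inv_pow, div_eq_mul_inv]
  have hdiv1 : ∀ c : ℝ, c / x = c * y := fun c => by rw [hy, div_eq_mul_inv]
  have hu : approxEquilibrium b s x = s * b * y - b * y ^ 2 + s * c₃ * y ^ 3 - c₄ * y ^ 4 := by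
    rw [approxEquilibrium, ← hy]
  have hs1 : ∀ c, 0 ≤ c → |s * c| = c := fun c hc => by rw [abs_mul, hsabs, one_mul, abs_of_nonneg hc]
  have htail : |s * c₃ * y ^ 3 - c₄ * y ^ 4| ≤ (c₃ + c₄) * y ^ 3 := by
    refine (abs_sub _ _).trans ?_
    rw [mul_assoc, hs1 _ (by positivity), abs_of_nonneg (by positivity : 0 ≤ c₄ * y ^ 4)]
    nlinarith
  have hhead : |s * b * y - b * y ^ 2| ≤ 2 * b * y := by
    refine (abs_sub _ _).trans ?_
    rw [mul_assoc, hs1 _ (by positivity), abs_of_nonneg (by positivity : 0 ≤ b * y ^ 2)]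
    nlinarith
  have huQ : |approxEquilibrium b s x| ≤ Q * y := by
    rw [hu, add_sub_assoc]
    refine (abs_add_le _ _).trans ?_
    nlinarith
  have hQ5 : 0 < Q ^ 5 := by positivity
  refine ⟨?_, ?_, ?_⟩
  · rw [hdiv1]
    exact huQ.trans (by gcongr; linarith)
  · rw [hdiv, hdiv1, hdiv, hu]
    rw [show s * b * y - b * y ^ 2 + s * c₃ * y ^ 3 - c₄ * y ^ 4 - (s * b * y - b * y ^ 2)
      = s * c₃ * y ^ 3 - c₄ * y ^ 4 by ring]
    exact htail.trans (mul_le_mul_of_nonneg_right (by linarith) (by positivity))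
  · have hPx := hPeq x hx0.ne' _ rfl
    rw [← hy] at hPx
    generalize approxEquilibrium b s x = u at hPx huQ
    have h1 := abs_sin_sub_cubic_le u
    have h2 := abs_sin_sub_cubic_le (2 * u)
    have hu5 : |u| ^ 5 ≤ Q ^ 5 * y ^ 5 := by rw [← mul_pow]; gcongr
    have h2' : |Real.sin (2 * u) - (2 * u - (2 * u) ^ 3 / 6)| ≤ 96 * (Q ^ 5 * y ^ 5) := by
      refine h2.trans ?_
      rw [abs_mul, mul_pow, abs_of_pos (by norm_num : (0 : ℝ) < 2)]
      linarith
    have h1' : |s * x * (Real.sin u - (u - u ^ 3 / 6))| ≤ 3 * (Q ^ 5 * y ^ 4) := by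
      rw [abs_mul, abs_mul, hsabs, one_mul, abs_of_pos hx0]
      calc x * |Real.sin u - (u - u ^ 3 / 6)| ≤ x * (3 * (Q ^ 5 * y ^ 5)) := by gcongr; linarith
        _ = 3 * (Q ^ 5 * y ^ 4) := by linear_combination 3 * Q ^ 5 * y ^ 4 * hxy
    have h3 : |y ^ 4 * P y| ≤ M * y ^ 4 := by
      rw [abs_mul, abs_of_pos (by positivity : 0 < y ^ 4), mul_comm]
      gcongr
      exact hM y ⟨hy0.le, hy1⟩
    have hy5 : y ^ 5 ≤ y ^ 4 := pow_le_pow_of_le_one hy0.le hy1 (show 4 ≤ 5 by norm_num)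
    have hkey : b ^ 2 * (equilibriumForce b s x u - approxEquilibriumDeriv₂ b s x)
        = y ^ 4 * P y - (Real.sin (2 * u) - (2 * u - (2 * u) ^ 3 / 6)) / 2
          - s * x * (Real.sin u - (u - u ^ 3 / 6)) := by
      rw [← hPx, equilibriumForce, mul_sub, mul_div_cancel₀ _ (by positivity : b ^ 2 ≠ 0)]
      ring
    rw [hkey, hdiv]
    refine (abs_sub _ _).trans ?_
    have h4 := abs_sub (y ^ 4 * P y) ((Real.sin (2 * u) - (2 * u - (2 * u) ^ 3 / 6)) / 2)
    rw [abs_div, abs_of_pos (by norm_num : (0 : ℝ) < 2)] at h4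
    have h5 : Q ^ 5 * y ^ 5 ≤ Q ^ 5 * y ^ 4 := by gcongr
    have h6 : 0 ≤ Q * y ^ 4 := by positivity
    rw [show (Q + M + 51 * Q ^ 5) * y ^ 4 = Q * y ^ 4 + M * y ^ 4 + 51 * (Q ^ 5 * y ^ 4) by ring]
    linarith

theorem contDiff_equilibriumForce (b s : ℝ) :
    ContDiff ℝ 1 (Function.uncurry (equilibriumForce b s)) := by
  have : ContDiff ℝ 1 fun p : ℝ × ℝ =>
      (b - Real.sin (2 * p.2) / 2 - s * p.1 * Real.sin p.2) / b ^ 2 := by fun_prop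
  exact this

theorem abs_equilibriumForce_le {b : ℝ} (hb : 0 < b) {s : ℝ} (hs : s = 1 ∨ s = -1) (x u : ℝ) :
    |equilibriumForce b s x u| ≤ (b + 1) / b ^ 2 * (1 + |x|) := by
  have hsabs : |s| = 1 := by rcases hs with rfl | rfl <;> simp
  rw [equilibriumForce, abs_div, abs_of_pos (by positivity : 0 < b ^ 2), div_mul_eq_mul_div]
  gcongr
  have h1 := abs_sub (b - Real.sin (2 * u) / 2) (s * x * Real.sin u)
  have h2 := abs_sub b (Real.sin (2 * u) / 2)
  have h3 := Real.abs_sin_le_one (2 * u)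
  have h4 : |s * x * Real.sin u| ≤ |x| := by
    rw [abs_mul, abs_mul, hsabs, one_mul]
    exact mul_le_of_le_one_right (abs_nonneg _) (Real.abs_sin_le_one u)
  rw [abs_div, abs_of_pos hb, abs_of_pos (by norm_num : (0 : ℝ) < 2)] at h2
  nlinarith [abs_nonneg x]

theorem abs_equilibriumForce_sub_le {b : ℝ} (hb : 0 < b) {s : ℝ} (hs : s = 1 ∨ s = -1)
    (x u v : ℝ) :
    |equilibriumForce b s x u - equilibriumForce b s x v|
      ≤ (b + 1) / b ^ 2 * (1 + |x|) * |u - v| := by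
  have hsabs : |s| = 1 := by rcases hs with rfl | rfl <;> simp
  have hsin : ∀ u v : ℝ, |Real.sin u - Real.sin v| ≤ |u - v| := fun u v => by
    simpa [Real.dist_eq] using Real.lipschitzWith_sin.dist_le_mul u v
  rw [equilibriumForce, equilibriumForce, ← sub_div, abs_div, abs_of_pos (by positivity : 0 < b ^ 2),
    div_mul_eq_mul_div, div_mul_eq_mul_div]
  gcongr
  rw [show b - Real.sin (2 * u) / 2 - s * x * Real.sin u
      - (b - Real.sin (2 * v) / 2 - s * x * Real.sin v)
      = -((Real.sin (2 * u) - Real.sin (2 * v)) / 2) - s * x * (Real.sin u - Real.sin v) by ring]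
  refine (abs_sub _ _).trans ?_
  have h1 := hsin (2 * u) (2 * v)
  rw [← mul_sub, abs_mul, abs_of_pos (by norm_num : (0 : ℝ) < 2)] at h1
  have h2 : |s * x * (Real.sin u - Real.sin v)| ≤ |x| * |u - v| := by
    rw [abs_mul, abs_mul, hsabs, one_mul]
    exact mul_le_mul_of_nonneg_left (hsin u v) (abs_nonneg x)
  rw [abs_neg, abs_div, abs_of_pos (by norm_num : (0 : ℝ) < 2)]
  have h3 : 0 ≤ b * (1 + |x|) * |u - v| := by positivity
  linarith

end

end ParametricAutoresonance

/-! ### The stable case: backward energy estimate and compactness -/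

namespace ParametricAutoresonance

open Set Filter Topology

noncomputable section

/-- The force increment is, up to a cubically small error, linear. -/
theorem abs_equilibriumForce_increment_le {b : ℝ} (hb : 0 < b) {s : ℝ} (hs : s = 1 ∨ s = -1)
    {x : ℝ} (hx : 0 ≤ x) (u w : ℝ) :
    |b ^ 2 * (equilibriumForce b s x (u + w) - equilibriumForce b s x u) + (1 + s * x) * w|
      ≤ (2 + x / 2) * (|u| + |w|) ^ 2 * |w| := by
  have hsabs : |s| = 1 := by rcases hs with rfl | rfl <;> simp
  have h1 := abs_sin_add_sub_sin_sub_le u w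
  have h2 := abs_sin_add_sub_sin_sub_le (2 * u) (2 * w)
  have habs2 : |(2 : ℝ)| = 2 := abs_of_pos two_pos
  rw [abs_mul, abs_mul, habs2] at h2
  have hkey : b ^ 2 * (equilibriumForce b s x (u + w) - equilibriumForce b s x u) + (1 + s * x) * w
      = -((Real.sin (2 * u + 2 * w) - Real.sin (2 * u) - 2 * w) / 2)
        - s * x * (Real.sin (u + w) - Real.sin u - w) := by
    rw [equilibriumForce, equilibriumForce, mul_sub, mul_div_cancel₀ _ (by positivity : b ^ 2 ≠ 0),
      mul_div_cancel₀ _ (by positivity : b ^ 2 ≠ 0), mul_add 2 u w]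
    ring
  rw [hkey]
  refine (abs_sub _ _).trans ?_
  rw [abs_neg, abs_div, habs2, abs_mul, abs_mul s x, hsabs, one_mul, abs_of_nonneg hx]
  have h3 := mul_le_mul_of_nonneg_left h1 hx
  linarith

/-- A backward energy estimate for a perturbed oscillator with stiffness growing linearly. -/
theorem oscillator_energy_le {b K M X N : ℝ} (hb : 0 < b) (hK : 0 < K)
    (hM : M = K ^ 2 / (4 * b ^ 2) + 1) (hX₁ : 2 * M ≤ X) (hX₂ : K ^ 2 / b ^ 2 ≤ X)
    {w w' w₂ : ℝ → ℝ} (hw : ∀ x, X ≤ x → HasDerivAt w (w' x) x)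
    (hw' : ∀ x, X ≤ x → HasDerivAt w' (w₂ x) x)
    (heq : ∀ x, X ≤ x → |w x| ≤ 1 / x →
      |b ^ 2 * w₂ x + (x + 1) * w x| ≤ K / x ^ 4 + K * |w x| / x)
    (hN : w N = 0) (hN' : w' N = 0) {x : ℝ} (hx : x ∈ Icc X N) :
    b ^ 2 * w' x ^ 2 / 2 + (x + 1) * w x ^ 2 / 2 ≤ M / x ^ 6 := by
  have hM1 : 1 ≤ M := by rw [hM]; linarith [show 0 ≤ K ^ 2 / (4 * b ^ 2) by positivity]
  have hX : 1 ≤ X := by linarith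
  set E : ℝ → ℝ := fun x => b ^ 2 * w' x ^ 2 / 2 + (x + 1) * w x ^ 2 / 2 with hE
  have hEd : ∀ x, X ≤ x → HasDerivAt E
      (w' x * (b ^ 2 * w₂ x + (x + 1) * w x) + w x ^ 2 / 2) x := by
    intro x hx
    have h1 := (((hw' x hx).pow 2).const_mul (b ^ 2)).div_const 2
    have h2 := ((((hasDerivAt_id x).add_const 1)).mul ((hw x hx).pow 2)).div_const 2
    refine (h1.add h2).congr_deriv ?_
    simp only [id, Pi.pow_apply]
    push_cast
    ring
  -- The substitution t = -x turns the backward estimate into a forward barrier argument. The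
  -- derivative comparison is needed only where the energy equals M x⁻⁶.
  have hfence := image_le_of_deriv_right_lt_deriv_boundary' (f := fun t => E (-t))
    (f' := fun t => -(w' (-t) * (b ^ 2 * w₂ (-t) + (-t + 1) * w (-t)) + w (-t) ^ 2 / 2))
    (a := -N) (b := -X) (B := fun t => M * (-t)⁻¹ ^ 6) (B' := fun t => 6 * M * (-t)⁻¹ ^ 7)
    ?_ ?_ ?_ ?_ ?_ ?_
  · have := hfence (x := -x) ⟨by linarith [hx.2], by linarith [hx.1]⟩
    simp only [neg_neg] at this
    rwa [inv_pow, ← div_eq_mul_inv] at this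
  · intro t ht
    have h := (hEd (-t) (by linarith [ht.2])).continuousAt
    exact (h.comp continuous_neg.continuousAt).continuousWithinAt
  · intro t ht
    have h := (hEd (-t) (by linarith [ht.2])).comp t (hasDerivAt_neg t)
    exact (h.congr_deriv (by ring)).hasDerivWithinAt
  · simp only [neg_neg, hE, hN, hN']
    have : 0 ≤ M * N⁻¹ ^ 6 := by positivity
    linarith
  · intro t ht
    have h0 : -t ≠ 0 := by linarith [ht.2]
    have h := ((hasDerivAt_inv_pow h0 6).comp t (hasDerivAt_neg t)).continuousAt
    exact (h.const_mul M).continuousWithinAt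
  · intro t ht
    have h0 : -t ≠ 0 := by linarith [ht.2]
    have h := ((hasDerivAt_inv_pow h0 6).comp t (hasDerivAt_neg t)).const_mul M
    exact (h.congr_deriv (by push_cast; ring)).hasDerivWithinAt
  · intro t ht hEB
    have hxX : X ≤ -t := by linarith [ht.2]
    have heq' := heq (-t) hxX
    generalize -t = x at *
    have hx0 : 0 < x := by linarith
    obtain ⟨y, hy⟩ : ∃ y, y = x⁻¹ := ⟨_, rfl⟩
    have hy0 : 0 < y := by rw [hy]; positivity
    have hxy : x * y = 1 := by rw [hy]; exact mul_inv_cancel₀ hx0.ne'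
    have hy1 : y ≤ 1 := by rw [hy]; exact inv_le_one_of_one_le₀ (by linarith)
    have hMy : 2 * M * y ≤ 1 := by rw [← hxy]; gcongr; linarith
    have hKy : K ^ 2 / b ^ 2 * y ≤ 1 := by rw [← hxy]; gcongr; linarith
    rw [← hy] at hEB ⊢
    simp only [hE] at hEB
    have hw2 : w x ^ 2 ≤ 2 * M * y ^ 7 := by
      have h1 : x * w x ^ 2 ≤ 2 * M * y ^ 6 := by
        have : 0 ≤ b ^ 2 * w' x ^ 2 := by positivity
        nlinarith [sq_nonneg (w x)]
      calc w x ^ 2 = x * w x ^ 2 * y := by linear_combination -(w x ^ 2) * hxy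
        _ ≤ 2 * M * y ^ 6 * y := by gcongr
        _ = _ := by ring
    have hw'2 : b ^ 2 * w' x ^ 2 ≤ 2 * M * y ^ 6 := by
      have : 0 ≤ (x + 1) * w x ^ 2 := by positivity
      linarith
    -- Contact with the barrier itself yields the smallness under which `heq` may be used.
    have hsmall : |w x| ≤ y := by
      refine abs_le_of_sq_le_sq ?_ hy0.le
      have h5 : y ^ 7 ≤ y ^ 3 := pow_le_pow_of_le_one hy0.le hy1 (by norm_num)
      calc w x ^ 2 ≤ 2 * M * y ^ 7 := hw2
        _ ≤ 2 * M * y ^ 3 := by gcongr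
        _ = 2 * M * y * y ^ 2 := by ring
        _ ≤ 1 * y ^ 2 := by gcongr
        _ = y ^ 2 := one_mul _
    have hr := heq' (by rwa [one_div, ← hy])
    rw [div_eq_mul_inv, ← inv_pow, div_eq_mul_inv, ← hy] at hr
    set r := b ^ 2 * w₂ x + (x + 1) * w x with hrdef
    have h1 : -(w' x * r) ≤ |w' x| * (K * y ^ 4 + K * |w x| * y) :=
      (neg_le_abs _).trans (by rw [abs_mul]; gcongr)
    -- Young's inequality is balanced so that its w²/2 is cancelled by the -w²/2 that the growing
    -- stiffness contributes in backward time. The remaining terms total at most 4M y⁷, below the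
    -- barrier slope 6M y⁷.
    have h2 : K * |w x| * |w' x| * y ≤ w x ^ 2 / 2 + K ^ 2 * w' x ^ 2 * y ^ 2 / 2 := by
      have := sq_nonneg (|w x| - K * |w' x| * y)
      have e1 := sq_abs (w x)
      have e2 := sq_abs (w' x)
      rw [← e1, ← e2]
      linarith
    have h3 : K ^ 2 * w' x ^ 2 * y ^ 2 / 2 ≤ M * y ^ 7 := by
      calc K ^ 2 * w' x ^ 2 * y ^ 2 / 2 = K ^ 2 / b ^ 2 * (b ^ 2 * w' x ^ 2) * y ^ 2 / 2 := by
            field_simp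
        _ ≤ K ^ 2 / b ^ 2 * (2 * M * y ^ 6) * y ^ 2 / 2 := by gcongr
        _ = K ^ 2 / b ^ 2 * y * (M * y ^ 7) := by ring
        _ ≤ 1 * (M * y ^ 7) := by gcongr
        _ = _ := one_mul _
    have h4 : |w' x| * (K * y ^ 4) ≤ y * (b ^ 2 * w' x ^ 2) + K ^ 2 / (4 * b ^ 2) * y ^ 7 := by
      have h5 : 0 ≤ y * (b * |w' x| - K / (2 * b) * y ^ 3) ^ 2 := by positivity
      have e2 := sq_abs (w' x)
      rw [← e2]
      have e3 : y * (b * |w' x| - K / (2 * b) * y ^ 3) ^ 2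
          = y * (b ^ 2 * |w' x| ^ 2) + K ^ 2 / (4 * b ^ 2) * y ^ 7 - |w' x| * (K * y ^ 4) := by
        field_simp
        ring
      linarith
    have h6 : y * (b ^ 2 * w' x ^ 2) ≤ 2 * M * y ^ 7 := by
      calc _ ≤ y * (2 * M * y ^ 6) := by gcongr
        _ = _ := by ring
    have h7 : K ^ 2 / (4 * b ^ 2) * y ^ 7 ≤ M * y ^ 7 := by gcongr; linarith
    have h8 : 0 < M * y ^ 7 := by positivity
    linarith

/-- Existence of a slowly varying solution near a stable equilibrium. -/
theorem exists_phaseCurve_near_approxEquilibrium_elliptic {b : ℝ} (hb : 0 < b) :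
    ∃ z, IsPhaseCurve (equilibriumForce b 1) z ∧ ∃ X C : ℝ, ∀ x, X ≤ x →
      |(z x).1 - approxEquilibrium b 1 x| ≤ C / x ^ 3 := by
  have hs : (1 : ℝ) = 1 ∨ (1 : ℝ) = -1 := Or.inl rfl
  obtain ⟨K₀, hK₀, hbd⟩ := exists_approxEquilibrium_bounds hb hs
  -- From 2 + x/2 ≤ 3x for x ≥ 1 and |u| + |w| ≤ (K₀ + 1)/x; this value also exceeds K₀.
  set K := 3 * (K₀ + 1) ^ 2 with hKdef
  have hK : 0 < K := by positivity
  obtain ⟨M, hM⟩ : ∃ M, M = K ^ 2 / (4 * b ^ 2) + 1 := ⟨_, rfl⟩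
  have hM1 : 1 ≤ M := by rw [hM]; linarith [show 0 ≤ K ^ 2 / (4 * b ^ 2) by positivity]
  set X := 2 * M + K ^ 2 / b ^ 2 with hXdef
  have hKb : 0 ≤ K ^ 2 / b ^ 2 := by positivity
  have hX : 1 ≤ X := by linarith
  set u := approxEquilibrium b 1
  set u' := approxEquilibriumDeriv b 1
  have henergy : ∀ N z, IsPhaseCurve (equilibriumForce b 1) z → z N = (u N, u' N) →
      ∀ x ∈ Icc X N, b ^ 2 * ((z x).2 - u' x) ^ 2 / 2 + (x + 1) * ((z x).1 - u x) ^ 2 / 2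
        ≤ M / x ^ 6 := by
    intro N z hz hzN x hx
    refine oscillator_energy_le (w := fun x => (z x).1 - u x) (w' := fun x => (z x).2 - u' x)
      (w₂ := fun x => equilibriumForce b 1 x (z x).1 - approxEquilibriumDeriv₂ b 1 x)
      hb hK hM (by linarith) (by linarith) ?_ ?_ ?_ (by simp [hzN]) (by simp [hzN]) hx
    · intro x hx
      exact (hz.hasDerivAt_fst x).sub (hasDerivAt_approxEquilibrium b 1 (by linarith))
    · intro x hx
      exact (hz.hasDerivAt_snd x).sub (hasDerivAt_approxEquilibriumDeriv b 1 (by linarith))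
    · intro x hx hwx
      have hx1 : 1 ≤ x := by linarith
      have hx0 : 0 < x := by linarith
      obtain ⟨hu, -, hres⟩ := hbd x hx1
      have hinc := abs_equilibriumForce_increment_le hb hs hx0.le (u x) ((z x).1 - u x)
      rw [add_sub_cancel] at hinc
      set w := (z x).1 - u x
      have hsum : |u x| + |w| ≤ (K₀ + 1) / x := by rw [add_div]; exact add_le_add hu hwx
      have h1 : (2 + x / 2) * (|u x| + |w|) ^ 2 * |w| ≤ K * |w| / x := by
        calc (2 + x / 2) * (|u x| + |w|) ^ 2 * |w| ≤ (3 * x) * ((K₀ + 1) / x) ^ 2 * |w| := by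
              gcongr
              linarith
          _ = K * |w| / x := by rw [hKdef]; field_simp
      have h2 : K₀ / x ^ 4 ≤ K / x ^ 4 := by
        gcongr
        rw [hKdef]; nlinarith
      rw [show b ^ 2 * (equilibriumForce b 1 x (z x).1 - approxEquilibriumDeriv₂ b 1 x) + (x + 1) * w
        = b ^ 2 * (equilibriumForce b 1 x (u x) - approxEquilibriumDeriv₂ b 1 x)
          + (b ^ 2 * (equilibriumForce b 1 x (z x).1 - equilibriumForce b 1 x (u x))
            + (1 + 1 * x) * w) by ring]
      refine (abs_add_le _ _).trans ?_
      linarith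
  set C := Real.sqrt (2 * M) with hC
  have hCsq : C ^ 2 = 2 * M := Real.sq_sqrt (by linarith)
  have hbound : ∀ N z, IsPhaseCurve (equilibriumForce b 1) z → z N = (u N, u' N) →
      ∀ x ∈ Icc X N, |(z x).1 - u x| ≤ C / x ^ 3 ∧ |(z x).2 - u' x| ≤ C / b := by
    intro N z hz hzN x hx
    have h := henergy N z hz hzN x hx
    have hx1 : 1 ≤ x := by linarith [hx.1]
    have hx0 : 0 < x := by linarith
    have hC0 : 0 ≤ C := Real.sqrt_nonneg _
    constructor
    · refine abs_le_of_sq_le_sq ?_ (by positivity)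
      rw [div_pow, hCsq, ← pow_mul]
      have h1 : 0 ≤ b ^ 2 * ((z x).2 - u' x) ^ 2 := by positivity
      have h2 : 0 ≤ x * ((z x).1 - u x) ^ 2 := by positivity
      rw [mul_div_assoc]
      norm_num
      linarith
    · refine abs_le_of_sq_le_sq ?_ (by positivity)
      rw [div_pow, hCsq, le_div_iff₀ (by positivity)]
      have h1 : 0 ≤ (x + 1) * ((z x).1 - u x) ^ 2 := by positivity
      have h2 : M / x ^ 6 ≤ M := div_le_self (by linarith) (one_le_pow₀ hx1)
      linarith
  have hcurve := fun x₀ z₀ => exists_isPhaseCurve (contDiff_equilibriumForce b 1)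
    (abs_equilibriumForce_le hb hs) x₀ z₀
  choose Z hZ hZN using fun n : ℕ => hcurve (X + n) (u (X + n), u' (X + n))
  have hdata : ∀ n, Z n X ∈ Metric.closedBall ((u X, u' X) : ℝ × ℝ) (max C (C / b)) := by
    intro n
    obtain ⟨h1, h2⟩ := hbound _ _ (hZ n) (hZN n) X ⟨le_rfl, by simp⟩
    have hC0 : 0 ≤ C := Real.sqrt_nonneg _
    have h3 : C / X ^ 3 ≤ C := div_le_self hC0 (one_le_pow₀ hX)
    exact max_le_max (h1.trans h3) h2
  -- The curve through the limit a of the data at X inherits the bound at each x, since the bound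
  -- holds there for all large n.
  obtain ⟨a, -, ι, hι, hlim⟩ := (isCompact_closedBall _ _).tendsto_subseq hdata
  obtain ⟨z, hz, hza⟩ := hcurve X a
  refine ⟨z, hz, X, C, fun x hx => ?_⟩
  obtain ⟨L, -, hL⟩ := exists_dist_le_of_isPhaseCurve (abs_equilibriumForce_sub_le hb hs) X x
  have hconv : Tendsto (fun k => Z (ι k) x) atTop (𝓝 (z x)) := by
    rw [tendsto_iff_dist_tendsto_zero] at hlim ⊢
    refine squeeze_zero (fun _ => dist_nonneg) (fun k => ?_) (by simpa using hlim.const_mul L)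
    have := hL _ _ (hZ (ι k)) hz x ⟨hx, le_rfl⟩
    rwa [hza] at this
  have hconv1 : Tendsto (fun k => |(Z (ι k) x).1 - u x|) atTop (𝓝 |(z x).1 - u x|) :=
    (((continuous_fst.tendsto _).comp hconv).sub_const _).abs
  refine le_of_tendsto hconv1 ?_
  obtain ⟨n₀, hn₀⟩ := exists_nat_ge (x - X)
  filter_upwards [eventually_ge_atTop n₀] with k hk
  have hk' : (n₀ : ℝ) ≤ ι k := by exact_mod_cast hk.trans (hι.le_apply)
  exact (hbound _ _ (hZ (ι k)) (hZN (ι k)) x ⟨hx, by linarith⟩).1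

end

end ParametricAutoresonance

/-! ### The unstable case: shooting across a shrinking tube -/

namespace ParametricAutoresonance

open Set Filter Topology

noncomputable section

/-- A function that is convex where it is positive keeps growing once it is positive and
increasing. -/
theorem pos_of_deriv_pos_of_second_deriv_pos {d d' d₂ : ℝ → ℝ} {p q : ℝ}
    (hd : ∀ x ∈ Icc p q, HasDerivAt d (d' x) x) (hd' : ∀ x ∈ Icc p q, HasDerivAt d' (d₂ x) x)
    (hpos : ∀ x ∈ Icc p q, 0 < d x → 0 ≤ d₂ x) (h0 : 0 < d p) (h0' : 0 < d' p) :
    ∀ x ∈ Icc p q, 0 < d x := by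
  by_contra! hne
  obtain ⟨x₁, hx₁, hdx₁⟩ := hne
  have hcd : ContinuousOn d (Icc p q) := fun x hx => (hd x hx).continuousAt.continuousWithinAt
  have hcd' : ContinuousOn d' (Icc p q) := fun x hx => (hd' x hx).continuousAt.continuousWithinAt
  have hcl : IsCompact (Icc p q ∩ (fun x => min (d x) (d' x)) ⁻¹' Iic 0) :=
    isCompact_Icc.of_isClosed_subset
      ((ContinuousOn.inf hcd hcd').preimage_isClosed_of_isClosed isClosed_Icc isClosed_Iic) inter_subset_left
  -- At the first point where d or d' fails to be positive, both have been nondecreasing up to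
  -- there, hence are still positive.
  obtain ⟨y, ⟨hy, hymin⟩, hleast⟩ := hcl.exists_isLeast ⟨x₁, hx₁, min_le_of_left_le hdx₁⟩
  have hbefore : ∀ x ∈ Ico p y, 0 < d x ∧ 0 < d' x := by
    intro x hx
    by_contra hcon
    rw [← lt_min_iff, not_lt] at hcon
    exact absurd (hleast ⟨⟨hx.1, hx.2.le.trans hy.2⟩, hcon⟩) (not_le.2 hx.2)
  have hsub : Icc p y ⊆ Icc p q := Icc_subset_Icc_right hy.2
  have hmono : MonotoneOn d (Icc p y) := by
    refine monotoneOn_of_deriv_nonneg (convex_Icc _ _) (hcd.mono hsub) ?_ ?_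
    · intro x hx
      exact (hd x (hsub (interior_subset hx))).differentiableAt.differentiableWithinAt
    · intro x hx
      rw [(hd x (hsub (interior_subset hx))).deriv]
      rw [interior_Icc] at hx
      exact (hbefore x ⟨hx.1.le, hx.2⟩).2.le
  have hmono' : MonotoneOn d' (Icc p y) := by
    refine monotoneOn_of_deriv_nonneg (convex_Icc _ _) (hcd'.mono hsub) ?_ ?_
    · intro x hx
      exact (hd' x (hsub (interior_subset hx))).differentiableAt.differentiableWithinAt
    · intro x hx
      rw [(hd' x (hsub (interior_subset hx))).deriv]
      refine hpos x (hsub (interior_subset hx)) ?_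
      rw [interior_Icc] at hx
      exact (hbefore x ⟨hx.1.le, hx.2⟩).1
  have hp : p ∈ Icc p y := ⟨le_rfl, hy.1⟩
  have hyy : y ∈ Icc p y := ⟨hy.1, le_rfl⟩
  have h1 := hmono hp hyy hy.1
  have h2 := hmono' hp hyy hy.1
  have h3 : min (d y) (d' y) ≤ 0 := hymin
  exact absurd h3 (not_le.2 (lt_min (h0.trans_le h1) (h0'.trans_le h2)))

/-- The trajectory `w` leaves the tube `|w| ≤ x⁻³` at some time through the side `σ = ± 1`. -/
def ExitsTube (X σ : ℝ) (w w' : ℝ → ℝ) : Prop :=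
  ∃ x, X ≤ x ∧ (∀ t ∈ Icc X x, |w t| < 1 / 4) ∧ x⁻¹ ^ 3 < σ * w x ∧ -3 * x⁻¹ ^ 4 < σ * w' x

/-- Convexity of `σ w` outside the tube `|w| ≤ x⁻³`. -/
def RepelsTube (X : ℝ) (w w₂ : ℝ → ℝ) : Prop :=
  ∀ σ : ℝ, σ = 1 ∨ σ = -1 → ∀ x, X ≤ x → |w x| < 1 / 4 → x⁻¹ ^ 3 < σ * w x →
    12 * x⁻¹ ^ 5 ≤ σ * w₂ x

/-- The function d = σw - x⁻³ starts positive and increasing, and repulsion makes it convex wherever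
it is positive: 12x⁻⁵ is the second derivative of x⁻³. -/
theorem lt_of_exit_of_repelsTube {X : ℝ} (hX : 0 < X) {w w' w₂ : ℝ → ℝ}
    (hw : ∀ x, X ≤ x → HasDerivAt w (w' x) x) (hw' : ∀ x, X ≤ x → HasDerivAt w' (w₂ x) x)
    (hrep : RepelsTube X w w₂) {σ : ℝ} (hσ : σ = 1 ∨ σ = -1) {p q : ℝ} (hp : X ≤ p) (hpq : p ≤ q)
    (hsmall : ∀ t ∈ Icc X q, |w t| < 1 / 4) (h0 : p⁻¹ ^ 3 < σ * w p)
    (h0' : -3 * p⁻¹ ^ 4 < σ * w' p) : q⁻¹ ^ 3 < σ * w q := by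
  have hne : ∀ x ∈ Icc p q, x ≠ 0 := fun x hx => by linarith [hx.1]
  have := pos_of_deriv_pos_of_second_deriv_pos (d := fun x => σ * w x - x⁻¹ ^ 3)
    (d' := fun x => σ * w' x - -3 * x⁻¹ ^ 4) (d₂ := fun x => σ * w₂ x - 12 * x⁻¹ ^ 5)
    (p := p) (q := q) ?_ ?_ ?_ (by simpa using h0) (by linarith) q ⟨hpq, le_rfl⟩
  · simpa using this
  · intro x hx
    exact ((hw x (hp.trans hx.1)).const_mul σ).sub
      ((hasDerivAt_inv_pow (hne x hx) 3).congr_deriv (by norm_num))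
  · intro x hx
    exact ((hw' x (hp.trans hx.1)).const_mul σ).sub
      (((hasDerivAt_inv_pow (hne x hx) 4).const_mul (-3)).congr_deriv (by push_cast; ring))
  · intro x hx hpos
    have hxX := hp.trans hx.1
    exact sub_nonneg.2 (hrep σ hσ x hxX (hsmall x ⟨hxX, hx.2⟩) (by linarith))

/-- The smallness required up to the later exit lets the earlier exit persist until then, where w
would need both signs. -/
theorem not_exitsTube_both {X : ℝ} (hX : 0 < X) {w w' w₂ : ℝ → ℝ}
    (hw : ∀ x, X ≤ x → HasDerivAt w (w' x) x) (hw' : ∀ x, X ≤ x → HasDerivAt w' (w₂ x) x)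
    (hrep : RepelsTube X w w₂) : ¬ (ExitsTube X 1 w w' ∧ ExitsTube X (-1) w w') := by
  rintro ⟨⟨x, hx, hsx, h1, h1'⟩, y, hy, hsy, h2, h2'⟩
  have hx3 : 0 < x⁻¹ ^ 3 := pow_pos (inv_pos.2 (hX.trans_le hx)) 3
  have hy3 : 0 < y⁻¹ ^ 3 := pow_pos (inv_pos.2 (hX.trans_le hy)) 3
  rcases le_total x y with h | h
  · have := lt_of_exit_of_repelsTube hX hw hw' hrep (Or.inl rfl) hx h hsy h1 h1'
    linarith
  · have := lt_of_exit_of_repelsTube hX hw hw' hrep (Or.inr rfl) hy h hsx h2 h2'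
    linarith

/-- While it stays small, a trajectory that does not exit the tube stays in it. -/
theorem mul_le_of_not_exitsTube {X : ℝ} (hX : 0 < X) {w w' : ℝ → ℝ}
    (hw : ∀ x, X ≤ x → HasDerivAt w (w' x) x) {σ : ℝ} (hexit : ¬ ExitsTube X σ w w')
    (hinit : σ * w X ≤ X⁻¹ ^ 3) {q : ℝ} (hq : X ≤ q) (hsmall : ∀ t ∈ Icc X q, |w t| < 1 / 4) :
    σ * w q ≤ q⁻¹ ^ 3 := by
  by_contra! hcon
  set d : ℝ → ℝ := fun x => σ * w x - x⁻¹ ^ 3 with hd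
  have hdd : ∀ x, X ≤ x → HasDerivAt d (σ * w' x - -3 * x⁻¹ ^ 4) x := by
    intro x hx
    exact ((hw x hx).const_mul σ).sub
      ((hasDerivAt_inv_pow (by linarith) 3).congr_deriv (by norm_num))
  have hcd : ContinuousOn d (Icc X q) := fun x hx => (hdd x hx.1).continuousAt.continuousWithinAt
  have hcomp : IsCompact (Icc X q ∩ d ⁻¹' Iic 0) :=
    isCompact_Icc.of_isClosed_subset
      (hcd.preimage_isClosed_of_isClosed isClosed_Icc isClosed_Iic) inter_subset_left
  -- After the last time p inside the tube, the mean value theorem supplies a point with d > 0 and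
  -- d' > 0, which is an exit.
  obtain ⟨p, ⟨hp, hdp⟩, hgreat⟩ := hcomp.exists_isGreatest
    ⟨X, ⟨le_rfl, hq⟩, by simp only [hd, mem_preimage, mem_Iic]; linarith⟩
  have hdp' : d p ≤ 0 := hdp
  have hdq : 0 < d q := by simp only [hd]; linarith
  have hpq : p < q := lt_of_le_of_ne hp.2 (by rintro rfl; linarith)
  obtain ⟨y, hy, hslope⟩ := exists_hasDerivAt_eq_slope d _ hpq
    (hcd.mono (Icc_subset_Icc_left hp.1)) (fun x hx => hdd x (hp.1.trans hx.1.le))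
  have hslope_pos : 0 < (d q - d p) / (q - p) := div_pos (by linarith) (by linarith)
  rw [← hslope] at hslope_pos
  have hyX : X ≤ y := hp.1.trans hy.1.le
  have hdy : 0 < d y := by
    by_contra! hle
    exact absurd (hgreat ⟨⟨hyX, hy.2.le⟩, hle⟩) (not_le.2 hy.1)
  exact hexit ⟨y, hyX, fun t ht => hsmall t ⟨ht.1, ht.2.trans hy.2.le⟩,
    by simp only [hd] at hdy; linarith, by linarith⟩

/-- A trajectory that exits through neither side stays in the tube forever. -/
theorem abs_le_of_not_exitsTube {X : ℝ} (hX : 2 ≤ X) {w w' : ℝ → ℝ}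
    (hw : ∀ x, X ≤ x → HasDerivAt w (w' x) x) (hinit : |w X| < 1 / 4) (hinit' : w' X = w X)
    (hexit : ¬ ExitsTube X 1 w w') (hexit' : ¬ ExitsTube X (-1) w w') {x : ℝ} (hx : X ≤ x) :
    |w x| ≤ x⁻¹ ^ 3 := by
  have hX0 : 0 < X := by linarith
  -- Because w' X = w X, starting outside the tube already counts as an exit at time X.
  have hside : ∀ σ : ℝ, ¬ ExitsTube X σ w w' → σ * w X ≤ X⁻¹ ^ 3 := by
    intro σ hσ
    by_contra! hcon
    refine hσ ⟨X, le_rfl, fun t ht => ?_, hcon, ?_⟩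
    · rw [Icc_self, mem_singleton_iff] at ht
      rwa [ht]
    · have h1 : 0 < X⁻¹ ^ 3 := by positivity
      have h2 : 0 < X⁻¹ ^ 4 := by positivity
      rw [hinit']
      linarith
  have htube : ∀ q, X ≤ q → (∀ t ∈ Icc X q, |w t| < 1 / 4) → |w q| ≤ q⁻¹ ^ 3 := by
    intro q hq hs
    have h1 := mul_le_of_not_exitsTube hX0 hw hexit (hside _ hexit) hq hs
    have h2 := mul_le_of_not_exitsTube hX0 hw hexit' (hside _ hexit') hq hs
    exact abs_le.2 ⟨by linarith, by linarith⟩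
  have heighth : ∀ q, X ≤ q → q⁻¹ ^ 3 ≤ 1 / 8 := by
    intro q hq
    have : q⁻¹ ≤ 1 / 2 := by rw [inv_eq_one_div]; gcongr; linarith
    have hq0 : 0 ≤ q⁻¹ := inv_nonneg.2 (hX0.le.trans hq)
    calc q⁻¹ ^ 3 ≤ (1 / 2) ^ 3 := by gcongr
      _ = 1 / 8 := by norm_num
  have hcw : ∀ q, ContinuousOn (fun x => |w x|) (Icc X q) := fun q x hx =>
    (hw x hx.1).continuousAt.abs.continuousWithinAt
  have hX8 : |w X| ≤ 1 / 8 :=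
    (htube X le_rfl fun t ht => by rw [Icc_self, mem_singleton_iff] at ht; rwa [ht]).trans
      (heighth X le_rfl)
  -- Any level strictly between 1/8 and 1/4 would do: below 1/4 the trajectory is confined to the
  -- tube, where |w| ≤ 1/8, so the level is never reached.
  suffices hall : ∀ q, X ≤ q → |w q| < 3 / 16 from
    htube x hx fun t ht => (hall t ht.1).trans (by norm_num)
  intro q hq
  by_contra! hcon
  have hivt : ∀ r, X ≤ r → 3 / 16 ≤ |w r| → ∃ t ∈ Icc X r, |w t| = 3 / 16 := fun r hr h =>
    intermediate_value_Icc hr (hcw r) ⟨by linarith, h⟩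
  have hcomp : IsCompact (Icc X q ∩ (fun x => |w x|) ⁻¹' {3 / 16}) :=
    isCompact_Icc.of_isClosed_subset
      ((hcw q).preimage_isClosed_of_isClosed isClosed_Icc isClosed_singleton) inter_subset_left
  obtain ⟨t₁, ht₁, hwt₁⟩ := hivt q hq hcon
  obtain ⟨t, ⟨ht, hwt⟩, hleast⟩ := hcomp.exists_isLeast ⟨t₁, ht₁, hwt₁⟩
  have hwt' : |w t| = 3 / 16 := hwt
  have hle : ∀ r ∈ Icc X t, |w r| ≤ 3 / 16 := by
    intro r hr
    by_contra! hlt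
    obtain ⟨t₂, ht₂, hwt₂⟩ := hivt r hr.1 hlt.le
    have h1 := hleast ⟨⟨ht₂.1, ht₂.2.trans (hr.2.trans ht.2)⟩, hwt₂⟩
    have h2 : r = t := le_antisymm hr.2 (h1.trans ht₂.2)
    rw [h2] at hlt
    linarith
  have := (htube t ht.1 fun r hr => (hle r hr).trans_lt (by norm_num)).trans (heighth t ht.1)
  linarith

/-- Exiting the tube is an open condition on a parameter. -/
theorem isOpen_setOf_exitsTube {X σ : ℝ} (hσ : σ = 1 ∨ σ = -1) {w w' : ℝ → ℝ → ℝ}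
    (hc : ∀ c x, X ≤ x → ContinuousAt (w c) x)
    (hlip : ∀ x, ∃ L : ℝ, 0 < L ∧ ∀ c c', ∀ t ∈ Icc X x,
      |w c t - w c' t| ≤ L * |c - c'| ∧ |w' c t - w' c' t| ≤ L * |c - c'|) :
    IsOpen {c | ExitsTube X σ (w c) (w' c)} := by
  rw [Metric.isOpen_iff]
  rintro c ⟨x, hx, hsmall, h1, h2⟩
  obtain ⟨L, hL0, hL⟩ := hlip x
  obtain ⟨t₀, ht₀, hmax⟩ := isCompact_Icc.exists_isMaxOn (f := fun t => |w c t|)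
    (nonempty_Icc.2 hx) (fun t ht => (hc c t ht.1).abs.continuousWithinAt)
  have hσabs : |σ| = 1 := by rcases hσ with rfl | rfl <;> simp
  -- The least slack among the three strict inequalities defining an exit.
  set δ := min (1 / 4 - |w c t₀|) (min (σ * w c x - x⁻¹ ^ 3) (σ * w' c x - -3 * x⁻¹ ^ 4)) with hδ
  have hδ0 : 0 < δ := lt_min (sub_pos.2 (hsmall t₀ ht₀)) (lt_min (sub_pos.2 h1) (sub_pos.2 h2))
  have hδ1 : δ ≤ 1 / 4 - |w c t₀| := min_le_left _ _
  have hδ2 : δ ≤ σ * w c x - x⁻¹ ^ 3 := (min_le_right _ _).trans (min_le_left _ _)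
  have hδ3 : δ ≤ σ * w' c x - -3 * x⁻¹ ^ 4 := (min_le_right _ _).trans (min_le_right _ _)
  have hmulσ : ∀ r : ℝ, σ * r ≤ |r| := fun r => by
    have := le_abs_self (σ * r)
    rwa [abs_mul, hσabs, one_mul] at this
  refine ⟨δ / L, div_pos hδ0 hL0, fun c' hc' => ?_⟩
  have hclose : L * |c - c'| < δ := by
    rw [Metric.mem_ball, dist_comm, Real.dist_eq, lt_div_iff₀ hL0] at hc'
    linarith
  have hxx : x ∈ Icc X x := ⟨hx, le_rfl⟩
  refine ⟨x, hx, fun t ht => ?_, ?_, ?_⟩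
  · have h3 := (hL c c' t ht).1
    have h4 : |w c t| ≤ |w c t₀| := hmax ht
    have h5 := abs_sub_abs_le_abs_sub (w c' t) (w c t)
    rw [abs_sub_comm] at h5
    linarith
  · have h3 := (hL c c' x hxx).1
    have h4 := hmulσ (w c x - w c' x)
    linarith
  · have h3 := (hL c c' x hxx).2
    have h4 := hmulσ (w' c x - w' c' x)
    linarith

/-- Outside the tube, for x ≥ 4, the net linear push is at least (x/2)x⁻³ = x⁻²/2; for large x this
dominates both the residual K x⁻⁴ and the required 12b²x⁻⁵. -/
theorem RepelsTube.of_perturbed_linear {b K X : ℝ} (hb : 0 < b) (hK : 0 < K)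
    (hX : 4 + 4 * K + 48 * b ^ 2 ≤ X) {w w₂ : ℝ → ℝ}
    (heq : ∀ x, X ≤ x → |w x| < 1 / 4 →
      |b ^ 2 * w₂ x - (x - 1) * w x| ≤ K / x ^ 4 + (1 / 2 + x / 8) * |w x|) :
    RepelsTube X w w₂ := by
  intro σ hσ x hx hsmall hout
  have hb2 : 0 < b ^ 2 := by positivity
  have hx4 : 4 ≤ x := by linarith
  have hx0 : 0 < x := by linarith
  have h := heq x hx hsmall
  obtain ⟨y, hy⟩ : ∃ y, y = x⁻¹ := ⟨_, rfl⟩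
  have hy0 : 0 < y := by rw [hy]; positivity
  have hxy : x * y = 1 := by rw [hy]; exact mul_inv_cancel₀ hx0.ne'
  have hy1 : y ≤ 1 := by rw [hy]; exact inv_le_one_of_one_le₀ (by linarith)
  rw [← hy] at hout ⊢
  rw [div_eq_mul_inv, ← inv_pow, ← hy] at h
  have hv0 : 0 < σ * w x := lt_trans (by positivity) hout
  have habs : |w x| = σ * w x := by
    rcases hσ with rfl | rfl
    · rw [one_mul] at hv0 ⊢; exact abs_of_pos hv0
    · rw [abs_of_neg (by linarith)]; ring
  have hlow : (x - 1) * (σ * w x) - (K * y ^ 4 + (1 / 2 + x / 8) * (σ * w x))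
      ≤ b ^ 2 * (σ * w₂ x) := by
    rw [habs] at h
    have h' := abs_le.1 h
    rcases hσ with rfl | rfl <;> linarith [h'.1, h'.2]
  have h1 : x / 2 * y ^ 3 ≤ x / 2 * (σ * w x) := by gcongr
  have h2 : x / 2 * (σ * w x) ≤ (x - 1) * (σ * w x) - (1 / 2 + x / 8) * (σ * w x) := by nlinarith
  have h3 : x / 2 * y ^ 3 = y ^ 2 / 2 := by linear_combination y ^ 2 / 2 * hxy
  have hKy : 4 * K * y ≤ 1 := by rw [← hxy]; gcongr; linarith
  have hby : 48 * b ^ 2 * y ≤ 1 := by rw [← hxy]; gcongr; linarith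
  have h4 : K * y ^ 4 ≤ y ^ 2 / 4 := by
    calc K * y ^ 4 = 4 * K * y * y ^ 3 / 4 := by ring
      _ ≤ 1 * y ^ 3 / 4 := by gcongr
      _ ≤ 1 * y ^ 2 / 4 := by
        gcongr ?_ / 4
        have := pow_le_pow_of_le_one hy0.le hy1 (show 2 ≤ 3 by norm_num)
        linarith
      _ = _ := by ring
  have h5 : b ^ 2 * (12 * y ^ 5) ≤ y ^ 2 / 4 := by
    calc b ^ 2 * (12 * y ^ 5) = 48 * b ^ 2 * y * y ^ 4 / 4 := by ring
      _ ≤ 1 * y ^ 4 / 4 := by gcongr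
      _ ≤ 1 * y ^ 2 / 4 := by
        gcongr ?_ / 4
        have := pow_le_pow_of_le_one hy0.le hy1 (show 2 ≤ 4 by norm_num)
        linarith
      _ = _ := by ring
  exact le_of_mul_le_mul_left (by linarith) hb2

/-- Existence of a slowly varying solution near an unstable equilibrium, by shooting. -/
theorem exists_phaseCurve_near_approxEquilibrium_hyperbolic {b : ℝ} (hb : 0 < b) :
    ∃ z, IsPhaseCurve (equilibriumForce b (-1)) z ∧ ∃ X C : ℝ, ∀ x, X ≤ x →
      |(z x).1 - approxEquilibrium b (-1) x| ≤ C / x ^ 3 := by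
  have hs : (-1 : ℝ) = 1 ∨ (-1 : ℝ) = -1 := Or.inr rfl
  obtain ⟨K, hK, hbd⟩ := exists_approxEquilibrium_bounds hb hs
  set X := 5 + 4 * K + 48 * b ^ 2 with hXdef
  have hb2 : 0 < b ^ 2 := by positivity
  have hX5 : 5 < X := by linarith
  have hX0 : 0 < X := by linarith
  set u := approxEquilibrium b (-1)
  set u' := approxEquilibriumDeriv b (-1)
  -- Displacement and velocity are shifted by the same c, so that w' X = w X = c.
  choose Z hZ hZX using fun c : ℝ => exists_isPhaseCurve (contDiff_equilibriumForce b (-1))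
    (abs_equilibriumForce_le hb hs) X (u X + c, u' X + c)
  set w : ℝ → ℝ → ℝ := fun c x => (Z c x).1 - u x with hwdef
  set w' : ℝ → ℝ → ℝ := fun c x => (Z c x).2 - u' x with hw'def
  set w₂ : ℝ → ℝ → ℝ := fun c x =>
    equilibriumForce b (-1) x (Z c x).1 - approxEquilibriumDeriv₂ b (-1) x with hw₂def
  have hw : ∀ c x, X ≤ x → HasDerivAt (w c) (w' c x) x := fun c x hx =>
    ((hZ c).hasDerivAt_fst x).sub (hasDerivAt_approxEquilibrium b (-1) (by linarith))
  have hw' : ∀ c x, X ≤ x → HasDerivAt (w' c) (w₂ c x) x := fun c x hx =>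
    ((hZ c).hasDerivAt_snd x).sub (hasDerivAt_approxEquilibriumDeriv b (-1) (by linarith))
  have hwX : ∀ c, w c X = c := fun c => by simp [hwdef, hZX]
  have hw'X : ∀ c, w' c X = c := fun c => by simp [hw'def, hZX]
  have hrep : ∀ c, RepelsTube X (w c) (w₂ c) := by
    intro c
    refine RepelsTube.of_perturbed_linear hb hK (by linarith) fun x hx hsmall => ?_
    have hx0 : 0 < x := by linarith
    obtain ⟨hu, -, hres⟩ := hbd x (by linarith)
    have hinc := abs_equilibriumForce_increment_le hb hs hx0.le (u x) (w c x)
    rw [show u x + w c x = (Z c x).1 by simp [hwdef]] at hinc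
    have hu4 : |u x| ≤ 1 / 4 := by
      refine hu.trans ?_
      rw [div_le_iff₀ hx0]
      linarith
    -- Both |u| and |w| are at most 1/4, so the squared sum is at most 1/4.
    have h1 : (2 + x / 2) * (|u x| + |w c x|) ^ 2 * |w c x| ≤ (1 / 2 + x / 8) * |w c x| := by
      gcongr
      calc (2 + x / 2) * (|u x| + |w c x|) ^ 2 ≤ (2 + x / 2) * (1 / 4 + 1 / 4) ^ 2 := by gcongr
        _ = _ := by ring
    rw [show b ^ 2 * w₂ c x - (x - 1) * w c x
      = b ^ 2 * (equilibriumForce b (-1) x (u x) - approxEquilibriumDeriv₂ b (-1) x)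
        + (b ^ 2 * (equilibriumForce b (-1) x (Z c x).1 - equilibriumForce b (-1) x (u x))
          + (1 + -1 * x) * w c x) by rw [hw₂def]; ring]
    refine (abs_add_le _ _).trans ?_
    linarith
  have hlip : ∀ x, ∃ L : ℝ, 0 < L ∧ ∀ c c', ∀ t ∈ Icc X x,
      |w c t - w c' t| ≤ L * |c - c'| ∧ |w' c t - w' c' t| ≤ L * |c - c'| := by
    intro x
    obtain ⟨L, hL0, hL⟩ := exists_dist_le_of_isPhaseCurve (abs_equilibriumForce_sub_le hb hs) X x
    refine ⟨L, hL0, fun c c' t ht => ?_⟩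
    have h := hL _ _ (hZ c) (hZ c') t ht
    have hd : dist (Z c X) (Z c' X) = |c - c'| := by
      rw [hZX, hZX, Prod.dist_eq]
      simp [Real.dist_eq]
    rw [hd] at h
    have h1 : |(Z c t).1 - (Z c' t).1| ≤ dist (Z c t) (Z c' t) := le_max_left _ _
    have h2 : |(Z c t).2 - (Z c' t).2| ≤ dist (Z c t) (Z c' t) := le_max_right _ _
    simp only [hwdef, hw'def, sub_sub_sub_cancel_right]
    exact ⟨h1.trans h, h2.trans h⟩
  have hc : ∀ c x, X ≤ x → ContinuousAt (w c) x := fun c x hx => (hw c x hx).continuousAt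
  have hX3 : X⁻¹ ^ 3 < 1 / 5 := by
    have h1 : X⁻¹ < 1 / 5 := by rw [inv_eq_one_div]; gcongr
    have h2 : X⁻¹ ^ 3 ≤ X⁻¹ ^ 1 :=
      pow_le_pow_of_le_one (by positivity) (by linarith) (by norm_num)
    rw [pow_one] at h2
    linarith
  have hX4 : 0 < X⁻¹ ^ 4 := by positivity
  -- The endpoints ±1/5 lie between X⁻³ and 1/4 in absolute value, so these trajectories exit at
  -- time X itself.
  have hext : ∀ σ : ℝ, σ = 1 ∨ σ = -1 → ExitsTube X σ (w (σ / 5)) (w' (σ / 5)) := by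
    intro σ hσ
    have hσσ : σ * (σ / 5) = 1 / 5 := by rcases hσ with rfl | rfl <;> norm_num
    refine ⟨X, le_rfl, fun t ht => ?_, ?_, ?_⟩
    · rw [Icc_self, mem_singleton_iff] at ht
      rw [ht, hwX]
      rcases hσ with rfl | rfl <;> norm_num [abs_lt]
    · rwa [hwX, hσσ]
    · rw [hw'X, hσσ]; linarith
  obtain ⟨c, hcI, hc1, hc2⟩ : ∃ c ∈ Icc (-1 / 5 : ℝ) (1 / 5),
      ¬ ExitsTube X 1 (w c) (w' c) ∧ ¬ ExitsTube X (-1) (w c) (w' c) := by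
    by_contra! hcon
    obtain ⟨c, -, hc1, hc2⟩ := isPreconnected_Icc _ _
      (isOpen_setOf_exitsTube (Or.inl rfl) hc hlip) (isOpen_setOf_exitsTube (Or.inr rfl) hc hlip)
      (fun c hcI => or_iff_not_imp_left.2 (hcon c hcI))
      ⟨1 / 5, by norm_num, hext 1 (Or.inl rfl)⟩ ⟨-1 / 5, by norm_num, hext (-1) (Or.inr rfl)⟩
    exact not_exitsTube_both hX0 (hw c) (hw' c) (hrep c) ⟨hc1, hc2⟩
  refine ⟨Z c, hZ c, X, 1, fun x hx => ?_⟩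
  have hc4 : |w c X| < 1 / 4 := by
    rw [hwX, abs_lt]
    constructor <;> linarith [hcI.1, hcI.2]
  have := abs_le_of_not_exitsTube (by linarith) (hw c) hc4 (by rw [hw'X, hwX]) hc1 hc2 hx
  rwa [inv_pow, ← one_div] at this

end

end ParametricAutoresonance

/-! ### Return to the original variables -/

namespace ParametricAutoresonance

noncomputable section

/-- The third and fourth terms of the expansion served only to make the residual small; they are now
absorbed into O(x⁻³). -/
theorem exists_phaseCurve_asymptotics {b : ℝ} (hb : 0 < b) {s : ℝ} (hs : s = 1 ∨ s = -1) :
    ∃ z, IsPhaseCurve (equilibriumForce b s) z ∧ ∃ X C : ℝ, 0 < X ∧ ∀ x, X ≤ x →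
      |(z x).1 - (s * b / x - b / x ^ 2)| ≤ C / x ^ 3 := by
  obtain ⟨z, hz, X, C, hC⟩ : ∃ z, IsPhaseCurve (equilibriumForce b s) z ∧ ∃ X C : ℝ, ∀ x, X ≤ x →
      |(z x).1 - approxEquilibrium b s x| ≤ C / x ^ 3 := by
    rcases hs with rfl | rfl
    · exact exists_phaseCurve_near_approxEquilibrium_elliptic hb
    · exact exists_phaseCurve_near_approxEquilibrium_hyperbolic hb
  obtain ⟨K, -, hK⟩ := exists_approxEquilibrium_bounds hb hs
  refine ⟨z, hz, max X 1, C + K, by positivity, fun x hx => ?_⟩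
  have h1 := hC x ((le_max_left _ _).trans hx)
  have h2 := (hK x ((le_max_right _ _).trans hx)).2.1
  rw [add_div]
  exact (abs_sub_le _ _ _).trans (add_le_add h1 h2)

/-- Rescaling time turns a phase curve into a solution of the original equation. -/
theorem isSolution_of_isPhaseCurve {lam ε : ℝ} (hlam : 0 < lam) (hε : 0 < ε) (k : ℤ)
    {z : ℝ → ℝ × ℝ} (hz : IsPhaseCurve (equilibriumForce (lam ^ 2 / 2) ((-1) ^ k)) z) :
    IsSolution lam ε
      fun θ => (z (1 / ε ^ 2 + lam ^ 2 / 2 * ε * θ)).1 + k * Real.pi := by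
  set b := lam ^ 2 / 2 with hbdef
  set s : ℝ := (-1) ^ k
  set x : ℝ → ℝ := fun θ => 1 / ε ^ 2 + b * ε * θ with hxdef
  have hb : b ≠ 0 := by positivity
  have hx : ∀ θ, HasDerivAt x (b * ε) θ := fun θ =>
    (((hasDerivAt_id θ).const_mul (b * ε)).const_add (1 / ε ^ 2)).congr_deriv (mul_one _)
  have h1 : ∀ θ, HasDerivAt (fun θ => (z (x θ)).1 + k * Real.pi) ((z (x θ)).2 * (b * ε)) θ :=
    fun θ => ((hz.hasDerivAt_fst (x θ)).comp θ (hx θ)).add_const _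
  have hd : deriv (fun θ => (z (x θ)).1 + k * Real.pi) = fun θ => (z (x θ)).2 * (b * ε) :=
    funext fun θ => (h1 θ).deriv
  have h2 : ∀ θ, HasDerivAt (fun θ => (z (x θ)).2 * (b * ε))
      (equilibriumForce b s (x θ) (z (x θ)).1 * (b * ε) * (b * ε)) θ :=
    fun θ => ((hz.hasDerivAt_snd (x θ)).comp θ (hx θ)).mul_const _
  refine ⟨fun θ => (h1 θ).differentiableAt, ?_, fun θ => ?_⟩
  · rw [hd]
    exact fun θ => (h2 θ).differentiableAt
  · rw [hd, (h2 θ).deriv]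
    have hsin2 : Real.sin (2 * ((z (x θ)).1 + k * Real.pi)) = Real.sin (2 * (z (x θ)).1) := by
      rw [show 2 * ((z (x θ)).1 + k * Real.pi) = 2 * (z (x θ)).1 + k * (2 * Real.pi) by ring,
        Real.sin_add_int_mul_two_pi]
    have hεx : ε ^ 2 * x θ = 1 + b * ε ^ 3 * θ := by
      rw [hxdef]; field_simp
    rw [hsin2, Real.sin_add_int_mul_pi, equilibriumForce]
    change _ + s * _ - _ + _ = _ * (s * _)
    generalize Real.sin (z (x θ)).1 = σ
    generalize Real.sin (2 * (z (x θ)).1) = τ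
    field_simp
    linear_combination -2 * s * σ * hεx

/-- The explicit expansion in terms of the rescaled time `x = r ^ 2`. -/
theorem equilibriumExpansion_eq {lam r : ℝ} (hlam : 0 < lam) (hr : 0 < r) (k : ℤ) :
    equilibriumExpansion lam k (4 / (3 * lam ^ 2) * r ^ 3)
      = Real.pi * k + ((-1) ^ k * (lam ^ 2 / 2) / r ^ 2 - lam ^ 2 / 2 / (r ^ 2) ^ 2) := by
  have hcube : ∀ y : ℝ, 0 ≤ y → (y ^ 3) ^ (1 / 3 : ℝ) = y := fun y hy => by
    rw [← Real.rpow_natCast, ← Real.rpow_mul hy]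
    norm_num
  have h1 : 2 * lam ^ 2 / (9 * (4 / (3 * lam ^ 2) * r ^ 3) ^ 2) = (lam ^ 2 / 2 / r ^ 2) ^ 3 := by
    field_simp
    norm_num
  have h2 : 4 / (3 * lam ^ 2 * (4 / (3 * lam ^ 2) * r ^ 3)) = (1 / r) ^ 3 := by
    field_simp
  rw [equilibriumExpansion, h1, h2, hcube _ (by positivity), hcube _ (by positivity)]
  field_simp
  ring

theorem wkbS_eq {lam ε θ x : ℝ} (hε : 0 < ε) (hx : x = 1 / ε ^ 2 + lam ^ 2 / 2 * ε * θ) :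
    wkbS lam ε θ = 4 / (3 * lam ^ 2) * Real.sqrt x ^ 3 := by
  have h : 1 + lam ^ 2 * (ε ^ 3 * θ) / 2 = ε ^ 2 * x := by
    rw [hx]; field_simp
  rw [wkbS, h, Real.sqrt_mul (by positivity), Real.sqrt_sq hε.le, mul_pow, ← mul_assoc]
  congr 1
  by_cases hl : lam = 0
  · simp [hl]
  · field_simp

end

end ParametricAutoresonance

theorem theorem1 (lam : ℝ) (hlam : 0 < lam) (k : ℤ) :
    ∃ C S₀ : ℝ, 0 < S₀ ∧
      ∀ ε : ℝ, 0 < ε →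
        ∃ φ : ℝ → ℝ, ParametricAutoresonance.IsSolution lam ε φ ∧
          ∀ θ : ℝ, S₀ ≤ ParametricAutoresonance.wkbS lam ε θ →
            |φ θ - ParametricAutoresonance.equilibriumExpansion lam k
                (ParametricAutoresonance.wkbS lam ε θ)|
              ≤ C / (ParametricAutoresonance.wkbS lam ε θ) ^ 2 := by
  have hs : ((-1 : ℝ) ^ k) = 1 ∨ ((-1 : ℝ) ^ k) = -1 := by
    rcases Int.even_or_odd k with h | h
    · exact Or.inl h.neg_one_zpow
    · exact Or.inr h.neg_one_zpow
  obtain ⟨z, hz, X, C, hX, hC⟩ := ParametricAutoresonance.exists_phaseCurve_asymptotics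
    (by positivity : 0 < lam ^ 2 / 2) hs
  -- Since S = 4/(3λ²) x^(3/2), the error C x⁻³ is this constant divided by S², and S₀ is the value
  -- of S at x = X.
  refine ⟨(4 / (3 * lam ^ 2)) ^ 2 * C, 4 / (3 * lam ^ 2) * Real.sqrt X ^ 3, by positivity,
    fun ε hε => ⟨_, ParametricAutoresonance.isSolution_of_isPhaseCurve hlam hε k hz,
      fun θ hθ => ?_⟩⟩
  rw [ParametricAutoresonance.wkbS_eq hε rfl] at hθ ⊢
  generalize 1 / ε ^ 2 + lam ^ 2 / 2 * ε * θ = x at hθ ⊢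
  have hsqrt : Real.sqrt X ≤ Real.sqrt x :=
    le_of_pow_le_pow_left₀ three_ne_zero (Real.sqrt_nonneg _)
      (le_of_mul_le_mul_left hθ (by positivity))
  -- Positivity of X rules out negative x, at which the real square root would be 0.
  have hXx : X ≤ x := (Real.sqrt_le_sqrt_iff' hX).1 hsqrt
  have hr : 0 < Real.sqrt x := Real.sqrt_pos.2 (hX.trans_le hXx)
  have hx2 : Real.sqrt x ^ 2 = x := Real.sq_sqrt (hX.le.trans hXx)
  have h := hC x hXx
  rw [ParametricAutoresonance.equilibriumExpansion_eq hlam hr k, mul_comm (k : ℝ),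
    add_comm (z x).1, add_sub_add_left_eq_sub, hx2, mul_pow, ← pow_mul, mul_comm 3 2, pow_mul, hx2,
    mul_div_mul_left _ _ (by positivity)]
  exact h
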